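/- Let $\lambda>0$ and let $F_X$ be an arbitrary probability distribution on $(0,\infty)$ (no moment or stability condition is assumed). For an integer $n\ge 1$, the $(n,1)$ fork-join system is the following queueing system with $n$ servers, empty at time $0$. Jobs $0,1,2,\dots$ arrive according to a Poisson process of rate $\lambda$. Each arriving job is forked into $n$ tasks that join first-come first-served queues at the $n$ servers, one task per server. The service times of the tasks have distribution $F_X$ and are i.i.d. across jobs and servers and independent of the arrival process. When any one task of a job is served, the job is complete, and its remaining tasks are canceled and leave their queues (or servers) immediately. The latency $T^{(n)}_j$ of job $j$ is the time from its arrival until the first of its tasks is complete. For every $n\ge1$ the law of $T^{(n)}_j$ converges weakly on $[0,\infty]$, as $j\to\infty$, to a probability measure $\pi_n$ on $[0,\infty]$ (the steady-state law of the latency), and $\mathbb{E}[T^{(n)}_j]$ converges in $[0,\infty]$ to the mean of $\pi_n$. The expected (steady-state) latency $$\mathbb{E}[T^{(n)}] := \int_{[0,\infty]} t\,\pi_n(dt)=\lim_{j\to\infty}\mathbb{E}[T^{(n)}_j]\in[0,\infty]$$ is non-increasing in $n$: if $1\le n\le m$, then $\mathbb{E}[T^{(m)}]\le \mathbb{E}[T^{(n)}]$.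 -/

import Mathlib

open MeasureTheory ProbabilityTheory Filter Topology
open scoped ENNReal

namespace ForkJoin

/-- The instant at which the `j`-th job (counted from `0`) arrives, when `τ 0` is the time until the
first arrival and `τ (j + 1)` the time between the arrivals of jobs `j` and `j + 1`. -/
noncomputable def arrivalTime (τ : ℕ → ℝ) (j : ℕ) : ℝ :=
  ∑ l ∈ Finset.range (j + 1), τ l

/-- The `n` servers with first-come first-served queues: `serverFree n a x j i` is the first instant
from which server `i` is no longer needed by any of the jobs `0, …, j - 1`, when job `j` arrives at
time `a j` and its task at server `k` requires a service of length `x j k`. The system is empty at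
time `0`.

The task of job `j` at server `k` would enter service at `max (a j) (serverFree n a x j k)` and, if
not canceled, would be served `x j k` later; the job leaves at the first of these completions, and
all its other tasks are canceled at that instant. So a server that has started a task of job `j`
is released at that instant, and a server still needed by earlier jobs at that instant just
forgets its task of job `j`: in both cases it is released by the jobs `0, …, j` at the later one of
the departure of job `j` and the time `serverFree n a x j i`. -/
noncomputable def serverFree (n : ℕ) (a : ℕ → ℝ) (x : ℕ → Fin n → ℝ) : ℕ → Fin n → ℝ
  | 0, _ => 0
  | j + 1, i => max (serverFree n a x j i) (⨅ k, (max (a j) (serverFree n a x j k) + x j k))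

/-- The instant at which the task of job `j` reaches the head of the queue of server `i`
(if it is not canceled before). -/
noncomputable def taskStart (n : ℕ) (a : ℕ → ℝ) (x : ℕ → Fin n → ℝ) (j : ℕ) (i : Fin n) : ℝ :=
  max (a j) (serverFree n a x j i)

/-- The instant at which the first of the `n` tasks of job `j` is served. -/
noncomputable def departureTime (n : ℕ) (a : ℕ → ℝ) (x : ℕ → Fin n → ℝ) (j : ℕ) : ℝ :=
  ⨅ i, (taskStart n a x j i + x j i)

/-- The latency of job `j`: the time from its arrival until one of its tasks is complete. -/
noncomputable def latency (n : ℕ) (τ : ℕ → ℝ) (x : ℕ → Fin n → ℝ) (j : ℕ) : ℝ :=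
  departureTime n (arrivalTime τ) x j - arrivalTime τ j

/-- The random input of a system with `n` servers: jobs arrive according to a Poisson process of
rate `r` (the interarrival times `τ` are i.i.d. exponential), the service times `X j i` of job `j`
at server `i` have law `μ`, and all these random variables are jointly independent. -/
structure IsInput {Ω : Type*} [MeasurableSpace Ω] (P : Measure Ω) (n : ℕ) (r : ℝ) (μ : Measure ℝ)
    (τ : ℕ → Ω → ℝ) (X : ℕ → Fin n → Ω → ℝ) : Prop where
  interarrival_law : ∀ j, HasLaw (τ j) (expMeasure r) P
  service_law : ∀ j i, HasLaw (X j i) μ P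
  indep : iIndepFun (fun k : ℕ ⊕ ℕ × Fin n => Sum.elim τ (fun p => X p.1 p.2) k) P

/-- The latency of job `j` as a random variable with values in `[0, ∞]`. -/
noncomputable def randomLatency {Ω : Type*} (n : ℕ) (τ : ℕ → Ω → ℝ) (X : ℕ → Fin n → Ω → ℝ)
    (j : ℕ) (ω : Ω) : ℝ≥0∞ :=
  ENNReal.ofReal (latency n (fun l => τ l ω) (fun l i => X l i ω) j)

/-- `π` is the steady-state law of the latency: the weak limit, on `[0, ∞]`, of the law of the
latency of the `j`-th job as `j → ∞`. It charges `∞` if the system is unstable. -/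
def IsSteadyStateLatencyLaw {Ω : Type*} [MeasurableSpace Ω] (P : Measure Ω) [IsProbabilityMeasure P]
    (n : ℕ) (τ : ℕ → Ω → ℝ) (X : ℕ → Fin n → Ω → ℝ)
    (π : Measure ℝ≥0∞) [IsProbabilityMeasure π] : Prop :=
  TendstoInDistribution (randomLatency n τ X) atTop (id : ℝ≥0∞ → ℝ≥0∞) (fun _ => P) π

end ForkJoin

namespace ForkJoin

/-! Cancellation frees all servers at the same instant, so the system is a single-server queue with
service times `minService`. Unrolling Lindley's recursion gives the waiting time as the maximum of a
random walk read backwards from job `j` (`taskStart_sub_arrivalTime`). For each `j`, reversing the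
i.i.d. input preserves its law, so the latency has the law of `backwardLatency`, which increases
with `j` on each sample path. Its supremum, possibly `∞`, gives the steady-state law and, by
monotone convergence, the mean, without any stability assumption. To compare `n ≤ m`, run the
smaller system on `n` of the `m` servers: a minimum over fewer servers is larger, hence so is
`backwardLatency`. -/

/-- The service time of job `j` seen by the system: the least of the service times of its tasks. -/
noncomputable def minService {n : ℕ} (x : ℕ → Fin n → ℝ) (j : ℕ) : ℝ := ⨅ i, x j i

/-- The latency of job `j` in the system whose input is reversed in time: the service time of job
`0` plus the largest of the first partial sums of the random walk with steps
`minService x (i + 1) - τ (i + 1)`. -/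
noncomputable def backwardLatency (n : ℕ) (τ : ℕ → ℝ) (x : ℕ → Fin n → ℝ) (j : ℕ) : ℝ :=
  partialSups (fun k => ∑ i ∈ Finset.range k, (minService x (i + 1) - τ (i + 1))) j +
    minService x 0

/-- The reflection of `{0, …, j}`, extended by the identity. -/
def reflect (j l : ℕ) : ℕ := if l ≤ j then j - l else l

lemma reflect_injective (j : ℕ) : Function.Injective (reflect j) := by
  intro a b h
  unfold reflect at h
  split_ifs at h <;> omega

lemma reflect_of_le {j l : ℕ} (h : l ≤ j) : reflect j l = j - l := if_pos h

lemma arrivalTime_succ (τ : ℕ → ℝ) (j : ℕ) :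
    arrivalTime τ (j + 1) = arrivalTime τ j + τ (j + 1) :=
  Finset.sum_range_succ _ _

/-! ### Sample paths: reduction to a single-server queue -/

section Deterministic

variable {n : ℕ} {a : ℕ → ℝ} {τ : ℕ → ℝ} {x : ℕ → Fin n → ℝ}

lemma serverFree_eq (j : ℕ) (i k : Fin n) : serverFree n a x j i = serverFree n a x j k := by
  induction j with
  | zero => rfl
  | succ j ih => simp only [serverFree, ih]

lemma departureTime_eq (j : ℕ) (i : Fin n) :
    departureTime n a x j = taskStart n a x j i + minService x j := by
  have : Nonempty (Fin n) := ⟨i⟩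
  have h : ∀ k, taskStart n a x j k = taskStart n a x j i := fun k => by
    simp only [taskStart, serverFree_eq j k i]
  simp only [departureTime, h, minService]
  exact ((OrderIso.addLeft (taskStart n a x j i)).map_ciInf (Set.finite_range _).bddBelow).symm

lemma serverFree_succ (j : ℕ) (i : Fin n) (hx : 0 ≤ minService x j) :
    serverFree n a x (j + 1) i = taskStart n a x j i + minService x j := by
  rw [← departureTime_eq]
  refine max_eq_right ?_
  change _ ≤ departureTime n a x j
  rw [departureTime_eq j i]
  exact (le_max_right _ _).trans (le_add_of_nonneg_right hx)

/-- Every nonempty partial sum contains the first step `f 0`, which factors out of the maximum; the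
empty sum gives the `0`. This is the shape of one Lindley step. -/
lemma partialSups_sum_range_succ (f : ℕ → ℝ) (j : ℕ) :
    partialSups (fun k => ∑ i ∈ Finset.range k, f i) (j + 1) =
      max 0 (f 0 + partialSups (fun k => ∑ i ∈ Finset.range k, f (i + 1)) j) := by
  induction j with
  | zero => rw [partialSups_add_one]; simp
  | succ j ih =>
    rw [partialSups_add_one, ih, partialSups_add_one, Finset.sum_range_succ' f (j + 1),
      ← max_add_add_left, ← max_assoc, add_comm (f 0) (∑ i ∈ _, _)]

/-- A wait is the previous wait plus a service time minus an interarrival time, cut off at `0`. The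
service of job `j - (i + 1)` is paired with the gap following its arrival, which has index one
higher; hence the two reflections, about `j` and `j + 1`. -/
lemma taskStart_sub_arrivalTime (h₀ : 0 ≤ τ 0) (hx : ∀ j, 0 ≤ minService x j) (i : Fin n)
    (j : ℕ) :
    taskStart n (arrivalTime τ) x j i - arrivalTime τ j =
      partialSups (fun k => ∑ i ∈ Finset.range k,
        (minService x (j - (i + 1)) - τ (j + 1 - (i + 1)))) j := by
  induction j with
  | zero => simp [taskStart, serverFree, arrivalTime, h₀]
  | succ j ih =>
    have h : (fun k => ∑ i ∈ Finset.range k,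
        (minService x (j + 1 - (i + 1 + 1)) - τ (j + 1 + 1 - (i + 1 + 1)))) =
        fun k => ∑ i ∈ Finset.range k, (minService x (j - (i + 1)) - τ (j + 1 - (i + 1))) := by
      simp only [Nat.add_sub_add_right]
    rw [partialSups_sum_range_succ, h, ← ih, taskStart, serverFree_succ j i (hx j),
      arrivalTime_succ, ← max_sub_sub_right, sub_self]
    congr 1
    simp only [zero_add, Nat.add_sub_cancel]
    ring

lemma latency_eq_backwardLatency (hn : 1 ≤ n) (h₀ : 0 ≤ τ 0) (hx : ∀ j i, 0 ≤ x j i) (j : ℕ) :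
    latency n τ x j =
      backwardLatency n (fun l => τ (reflect (j + 1) l)) (fun l => x (reflect j l)) j := by
  have hx' : ∀ j, 0 ≤ minService x j := fun j => Real.iInf_nonneg (hx j)
  rw [latency, departureTime_eq j ⟨0, hn⟩, add_sub_right_comm, taskStart_sub_arrivalTime h₀ hx',
    backwardLatency]
  congr 1
  simp only [partialSups_apply]
  refine Finset.sup'_congr _ rfl fun k hk => Finset.sum_congr rfl fun i hi => ?_
  have : k ≤ j := by simpa using hk
  have : i < k := by simpa using hi
  simp only [minService]
  rw [reflect_of_le (by omega), reflect_of_le (by omega)]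

lemma backwardLatency_mono (n : ℕ) (τ : ℕ → ℝ) (x : ℕ → Fin n → ℝ) :
    Monotone (backwardLatency n τ x) := fun _ _ h =>
  add_le_add_left ((partialSups _).monotone h) _

lemma backwardLatency_le_of_castLE {m : ℕ} (hn : 1 ≤ n) (hnm : n ≤ m) (τ : ℕ → ℝ)
    (x : ℕ → Fin m → ℝ) (j : ℕ) :
    backwardLatency m τ x j ≤ backwardLatency n τ (fun l i => x l (Fin.castLE hnm i)) j := by
  have : Nonempty (Fin n) := ⟨⟨0, hn⟩⟩
  have h : ∀ l, minService x l ≤ minService (fun l i => x l (Fin.castLE hnm i)) l := fun l =>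
    le_ciInf fun i => ciInf_le (Set.finite_range _).bddBelow _
  exact add_le_add (partialSups_mono (fun k => Finset.sum_le_sum fun i _ =>
    sub_le_sub_right (h _) _) j) (h 0)

end Deterministic

/-! ### Laws: time reversal and the monotone limit -/

/-- The input of a system with `n` servers as a single family. -/
abbrev input {Ω : Type*} {n : ℕ} (τ : ℕ → Ω → ℝ) (X : ℕ → Fin n → Ω → ℝ)
    (k : ℕ ⊕ ℕ × Fin n) : Ω → ℝ :=
  Sum.elim τ (fun p => X p.1 p.2) k

/-- The latency of job `j` in the time-reversed system, with values in `[0, ∞]`. -/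
noncomputable def randomBackwardLatency {Ω : Type*} (n : ℕ) (τ : ℕ → Ω → ℝ)
    (X : ℕ → Fin n → Ω → ℝ) (j : ℕ) (ω : Ω) : ℝ≥0∞ :=
  ENNReal.ofReal (backwardLatency n (fun l => τ l ω) (fun l i => X l i ω) j)

lemma randomBackwardLatency_mono {Ω : Type*} {n : ℕ} {τ : ℕ → Ω → ℝ}
    {X : ℕ → Fin n → Ω → ℝ} (ω : Ω) :
    Monotone fun j => randomBackwardLatency n τ X j ω :=
  fun _ _ h => ENNReal.ofReal_le_ofReal (backwardLatency_mono _ _ _ h)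

lemma measurable_backwardLatency (n j : ℕ) :
    Measurable fun z : ℕ ⊕ ℕ × Fin n → ℝ =>
      ENNReal.ofReal (backwardLatency n (fun l => z (.inl l)) (fun l i => z (.inr (l, i))) j) := by
  have h : ∀ l, Measurable fun z : ℕ ⊕ ℕ × Fin n → ℝ =>
      minService (fun l i => z (.inr (l, i))) l := fun l =>
    Measurable.iInf fun i => measurable_pi_apply _
  have hsup : Measurable fun z : ℕ ⊕ ℕ × Fin n → ℝ =>
      partialSups (fun k => ∑ i ∈ Finset.range k,
        (minService (fun l i => z (.inr (l, i))) (i + 1) - z (.inl (i + 1)))) j := by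
    have hsum : ∀ k, Measurable fun z : ℕ ⊕ ℕ × Fin n → ℝ => ∑ i ∈ Finset.range k,
        (minService (fun l i => z (.inr (l, i))) (i + 1) - z (.inl (i + 1))) := fun k =>
      Finset.measurable_fun_sum _ fun i _ => (h _).sub (measurable_pi_apply _)
    induction j with
    | zero => simp
    | succ j ih =>
      simp only [partialSups_add_one]
      exact ih.sup (hsum _)
  exact ENNReal.measurable_ofReal.comp (hsup.add (h 0))

section Probability

variable {Ω Ω' : Type*} [MeasurableSpace Ω] [MeasurableSpace Ω'] {P : Measure Ω}
  {P' : Measure Ω'} {n : ℕ} {r : ℝ} {μ : Measure ℝ} {τ : ℕ → Ω → ℝ} {X : ℕ → Fin n → Ω → ℝ}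
  {τ' : ℕ → Ω' → ℝ} {X' : ℕ → Fin n → Ω' → ℝ}

/-- Injective relabelling keeps an i.i.d. family i.i.d. It serves both for time reversal and for
discarding servers. -/
lemma IsInput.comp {m : ℕ} (h : IsInput P n r μ τ X) {f g : ℕ → ℕ} {e : Fin m → Fin n}
    (hf : f.Injective) (hg : g.Injective) (he : e.Injective) :
    IsInput P m r μ (fun l => τ (f l)) (fun l i => X (g l) (e i)) where
  interarrival_law j := h.interarrival_law _
  service_law j i := h.service_law _ _
  indep := by
    convert! h.indep.precomp (hf.sumMap (hg.prodMap he)) using 1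
    ext k
    cases k <;> rfl

lemma IsInput.identDistrib (h : IsInput P n r μ τ X) (h' : IsInput P' n r μ τ' X') :
    IdentDistrib (fun ω => (input τ X · ω)) (fun ω => (input τ' X' · ω)) P P' := by
  refine IdentDistrib.pi (fun k => ?_) h.indep h'.indep
  rcases k with l | ⟨l, i⟩
  · exact ⟨(h.interarrival_law l).aemeasurable, (h'.interarrival_law l).aemeasurable,
      (h.interarrival_law l).map_eq.trans (h'.interarrival_law l).map_eq.symm⟩
  · exact ⟨(h.service_law l i).aemeasurable, (h'.service_law l i).aemeasurable,
      (h.service_law l i).map_eq.trans (h'.service_law l i).map_eq.symm⟩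

lemma IsInput.identDistrib_backwardLatency (h : IsInput P n r μ τ X)
    (h' : IsInput P' n r μ τ' X') (j : ℕ) :
    IdentDistrib (randomBackwardLatency n τ X j) (randomBackwardLatency n τ' X' j) P P' :=
  (h.identDistrib h').comp (measurable_backwardLatency n j)

lemma ae_nonneg_expMeasure (r : ℝ) : ∀ᵐ t ∂expMeasure r, 0 ≤ t := by
  rw [ae_iff]
  simp only [not_le]
  change expMeasure r (Set.Iio 0) = 0
  rw [expMeasure, gammaMeasure, withDensity_apply _ measurableSet_Iio]
  exact lintegral_gammaPDF_of_nonpos le_rfl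

lemma IsInput.identDistrib_latency (hn : 1 ≤ n) (hμ : ∀ᵐ t ∂μ, 0 < t)
    (h : IsInput P n r μ τ X) (j : ℕ) :
    IdentDistrib (randomLatency n τ X j) (randomBackwardLatency n τ X j) P P := by
  have h₀ : ∀ᵐ ω ∂P, 0 ≤ τ 0 ω :=
    ((h.interarrival_law 0).ae_iff (p := fun t => 0 ≤ t) (by fun_prop)).2 (ae_nonneg_expMeasure r)
  have hx : ∀ᵐ ω ∂P, ∀ l i, 0 ≤ X l i ω := by
    simp only [ae_all_iff]
    exact fun l i => ((h.service_law l i).ae_iff (p := fun t => 0 ≤ t) (by fun_prop)).2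
      (hμ.mono fun _ => le_of_lt)
  have hrev := h.comp (reflect_injective (j + 1)) (reflect_injective j) (e := id)
    Function.injective_id
  have hid := hrev.identDistrib_backwardLatency h j
  refine IdentDistrib.trans (IdentDistrib.of_ae_eq ?_ ?_).symm hid
  · exact hid.aemeasurable_fst
  · filter_upwards [h₀, hx] with ω h₀ hx
    simp only [randomBackwardLatency, randomLatency, id]
    rw [latency_eq_backwardLatency hn h₀ hx]

/-- The steady-state latency is the increasing limit of the latencies of the reversed system. -/
noncomputable def limitLatency {Ω : Type*} (n : ℕ) (τ : ℕ → Ω → ℝ) (X : ℕ → Fin n → Ω → ℝ)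
    (ω : Ω) : ℝ≥0∞ :=
  ⨆ j, randomBackwardLatency n τ X j ω

lemma IsInput.aemeasurable_backwardLatency (h : IsInput P n r μ τ X) (j : ℕ) :
    AEMeasurable (randomBackwardLatency n τ X j) P :=
  (h.identDistrib_backwardLatency h j).aemeasurable_fst

lemma IsInput.aemeasurable_limitLatency (h : IsInput P n r μ τ X) :
    AEMeasurable (limitLatency n τ X) P :=
  AEMeasurable.iSup h.aemeasurable_backwardLatency

lemma IsInput.lintegral_limitLatency (h : IsInput P n r μ τ X) :
    ∫⁻ ω, limitLatency n τ X ω ∂P = ⨆ j, ∫⁻ ω, randomBackwardLatency n τ X j ω ∂P :=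
  lintegral_iSup' h.aemeasurable_backwardLatency (.of_forall randomBackwardLatency_mono)

lemma IsInput.exists_steadyState [IsProbabilityMeasure P] (hn : 1 ≤ n) (hμ : ∀ᵐ t ∂μ, 0 < t)
    (h : IsInput P n r μ τ X) :
    ∃ π : ProbabilityMeasure ℝ≥0∞,
      IsSteadyStateLatencyLaw P n τ X (π : Measure ℝ≥0∞) ∧
      Tendsto (fun j => ∫⁻ ω, randomLatency n τ X j ω ∂P) atTop
        (𝓝 (∫⁻ t, t ∂(π : Measure ℝ≥0∞))) ∧
      ∫⁻ t, t ∂(π : Measure ℝ≥0∞) = ⨆ j, ∫⁻ ω, randomBackwardLatency n τ X j ω ∂P := by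
  have hm := h.aemeasurable_limitLatency
  have hlat := h.identDistrib_latency hn hμ
  have hmean : ∫⁻ t, t ∂(P.map (limitLatency n τ X)) =
      ⨆ j, ∫⁻ ω, randomBackwardLatency n τ X j ω ∂P := by
    rw [lintegral_map' aemeasurable_id' hm, h.lintegral_limitLatency]
  have : IsProbabilityMeasure (P.map (limitLatency n τ X)) := Measure.isProbabilityMeasure_map hm
  refine ⟨⟨P.map (limitLatency n τ X), this⟩, ?_, ?_, hmean⟩
  · simp only [ProbabilityMeasure.coe_mk]
    refine ⟨fun j => (hlat j).aemeasurable_fst, aemeasurable_id, ?_⟩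
    -- Only the reversed latencies converge pointwise; the limit passes to the actual ones because
    -- their laws agree for each `j`.
    have ht := (tendstoInDistribution_of_ae_tendsto (l := atTop) h.aemeasurable_backwardLatency hm
      (.of_forall fun ω => tendsto_atTop_iSup (randomBackwardLatency_mono ω))).tendsto
    simp only [Measure.map_id, (hlat _).map_eq]
    exact ht
  · simp only [ProbabilityMeasure.coe_mk]
    rw [hmean]
    simp only [(hlat _).lintegral_eq]
    exact tendsto_atTop_iSup fun i j hij => lintegral_mono fun ω =>
      randomBackwardLatency_mono ω hij

end Probability

end ForkJoin

theorem mainTheorem7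
    (r : ℝ) (hr : 0 < r)
    (μ : Measure ℝ) [IsProbabilityMeasure μ] (hμ : ∀ᵐ x ∂μ, 0 < x)
    (n m : ℕ) (hn : 1 ≤ n) (hnm : n ≤ m)
    {Ω₁ : Type*} [MeasurableSpace Ω₁] (P₁ : Measure Ω₁) [IsProbabilityMeasure P₁]
    (τ₁ : ℕ → Ω₁ → ℝ) (X₁ : ℕ → Fin n → Ω₁ → ℝ) (h₁ : ForkJoin.IsInput P₁ n r μ τ₁ X₁)
    {Ω₂ : Type*} [MeasurableSpace Ω₂] (P₂ : Measure Ω₂) [IsProbabilityMeasure P₂]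
    (τ₂ : ℕ → Ω₂ → ℝ) (X₂ : ℕ → Fin m → Ω₂ → ℝ) (h₂ : ForkJoin.IsInput P₂ m r μ τ₂ X₂) :
    ∃ π₁ π₂ : ProbabilityMeasure ℝ≥0∞,
      ForkJoin.IsSteadyStateLatencyLaw P₁ n τ₁ X₁ (π₁ : Measure ℝ≥0∞) ∧
      ForkJoin.IsSteadyStateLatencyLaw P₂ m τ₂ X₂ (π₂ : Measure ℝ≥0∞) ∧
      Tendsto (fun j => ∫⁻ ω, ForkJoin.randomLatency n τ₁ X₁ j ω ∂P₁) atTop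
        (𝓝 (∫⁻ t, t ∂(π₁ : Measure ℝ≥0∞))) ∧
      Tendsto (fun j => ∫⁻ ω, ForkJoin.randomLatency m τ₂ X₂ j ω ∂P₂) atTop
        (𝓝 (∫⁻ t, t ∂(π₂ : Measure ℝ≥0∞))) ∧
      ∫⁻ t, t ∂(π₂ : Measure ℝ≥0∞) ≤ ∫⁻ t, t ∂(π₁ : Measure ℝ≥0∞) := by
  obtain ⟨π₁, hπ₁, ht₁, hm₁⟩ := h₁.exists_steadyState hn hμ
  obtain ⟨π₂, hπ₂, ht₂, hm₂⟩ := h₂.exists_steadyState (hn.trans hnm) hμ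
  refine ⟨π₁, π₂, hπ₁, hπ₂, ht₁, ht₂, ?_⟩
  rw [hm₁, hm₂]
  refine iSup_mono fun j => ?_
  -- Coupling: the first `n` servers of the larger system form an input with the same law as the
  -- given smaller one.
  have h := h₂.comp Function.injective_id Function.injective_id (Fin.castLE_injective hnm)
  rw [(h₁.identDistrib_backwardLatency h j).lintegral_eq]
  exact lintegral_mono fun ω => ENNReal.ofReal_le_ofReal
    (ForkJoin.backwardLatency_le_of_castLE hn hnm _ _ j)
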